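/- All matrices are complex. For $n\times n$ matrices let $M\circ N$ denote the entrywise product, and for a matrix $M$ without zero entries let $M^{(-)}$ denote its entrywise inverse. For $n\times n$ matrices $A,B$ let $X_A(M)=AM$ and $\Delta_B(M)=B\circ M$ be the corresponding endomorphisms of the space of $n\times n$ matrices. The pair $(A,B)$ is a *one-sided Jones pair* if $X_A$ and $\Delta_B$ are invertible and $X_A\Delta_BX_A=\Delta_BX_A\Delta_B$; it is a *Jones pair* if $(A,B)$ and $(A,B^T)$ are both one-sided Jones pairs; and a Jones pair is *invertible* if moreover $A$ has no zero entry and $B$ is an invertible matrix. For an $m\times m$ matrix $W$ without zero entries, the *Nomura algebra* $\mathcal N_W$ is the set of all $m\times m$ matrices having every vector $We_i\circ W^{(-)}e_j$ ($1\le i,j\le m$) as an eigenvector. An $m\times m$ matrix $W$ without zero entries is a *spin model* if for some scalar $d$ with $d^2=m$ (the loop variable) it satisfies: (I) for some scalar $a\neq0$, all diagonal entries of $W$ equal $a$ and all row sums and column sums of $W$ equal $da^{-1}$; (II) $W\,(W^{(-)})^T=mI$; (III) $\sum_{k} W_{h,k}W_{k,i}/W_{k,j}=d\,W_{h,i}/(W_{i,j}W_{h,j})$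 for all $h,i,j$. **Lemma.** Let $(A,B)$ be an invertible Jones pair of $n\times n$ matrices, let $C$ be an invertible diagonal matrix with $A^T=C^{-2}AC^2$, and let $$W=\begin{pmatrix}A^T&-A^T\\ (B^{(-)})^TC&(B^{(-)})^TC\end{pmatrix}.$$ If $\mathcal N_W=\mathcal N_{W^T}$, then there is a nonzero scalar $\alpha$ such that $\alpha B$ is a spin model. -/

import Mathlib

open scoped Matrix

namespace JonesPairs

noncomputable section

variable {ι : Type*}

/-- The Schur (entrywise) inverse of a matrix; meaningful when no entry vanishes. -/
def schurInv (M : Matrix ι ι ℂ) : Matrix ι ι ℂ := Matrix.of fun i j => (M i j)⁻¹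

/-- A matrix is Schur invertible if all its entries are nonzero. -/
def SchurInvertible (M : Matrix ι ι ℂ) : Prop := ∀ i j, M i j ≠ 0

variable [Fintype ι] [DecidableEq ι]

/-- The endomorphism `X_A : M ↦ A M` of the space of square matrices. -/
def opX (A : Matrix ι ι ℂ) : Module.End ℂ (Matrix ι ι ℂ) := LinearMap.mulLeft ℂ A

/-- The endomorphism `Δ_B : M ↦ B ∘ M` (entrywise product) of the space of square matrices. -/
def opD (B : Matrix ι ι ℂ) : Module.End ℂ (Matrix ι ι ℂ) where
  toFun M := B ⊙ M
  map_add' M N := Matrix.hadamard_add B M N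
  map_smul' c M := Matrix.hadamard_smul B M c

/-- `(A, B)` is a one-sided Jones pair: `X_A` and `Δ_B` are invertible and satisfy the
braid relation. -/
structure IsOneSidedJonesPair (A B : Matrix ι ι ℂ) : Prop where
  isUnit_opX : IsUnit (opX A)
  isUnit_opD : IsUnit (opD B)
  braid : opX A * opD B * opX A = opD B * opX A * opD B

/-- `(A, B)` is a Jones pair: both `(A, B)` and `(A, Bᵀ)` are one-sided Jones pairs. -/
structure IsJonesPair (A B : Matrix ι ι ℂ) : Prop where
  left : IsOneSidedJonesPair A B
  right : IsOneSidedJonesPair A Bᵀ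

/-- An invertible Jones pair: moreover `A` is Schur invertible and `B` is invertible. -/
structure IsInvertibleJonesPair (A B : Matrix ι ι ℂ) : Prop where
  isJonesPair : IsJonesPair A B
  schurInvertible : SchurInvertible A
  isUnit : IsUnit B

/-- A type-II matrix: `W (W⁽⁻⁾)ᵀ = n I`. -/
def IsTypeII (W : Matrix ι ι ℂ) : Prop :=
  SchurInvertible W ∧ W * (schurInv W)ᵀ = (Fintype.card ι : ℂ) • (1 : Matrix ι ι ℂ)

/-- The vector `W eᵢ ∘ W⁽⁻⁾ eⱼ`. -/
def ratioVec (W : Matrix ι ι ℂ) (i j : ι) : ι → ℂ := fun k => W k i * schurInv W k j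

/-- The Nomura algebra of `W`: the matrices having every `W eᵢ ∘ W⁽⁻⁾ eⱼ` as an eigenvector. -/
def nomura (W : Matrix ι ι ℂ) : Subalgebra ℂ (Matrix ι ι ℂ) where
  carrier := {M | ∀ i j, ∃ μ : ℂ, M *ᵥ ratioVec W i j = μ • ratioVec W i j}
  mul_mem' := by
    intro M N hM hN i j
    obtain ⟨μ, hμ⟩ := hM i j
    obtain ⟨ν, hν⟩ := hN i j
    exact ⟨ν * μ, by rw [← Matrix.mulVec_mulVec, hν, Matrix.mulVec_smul, hμ, smul_smul]⟩
  add_mem' := by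
    intro M N hM hN i j
    obtain ⟨μ, hμ⟩ := hM i j
    obtain ⟨ν, hν⟩ := hN i j
    exact ⟨μ + ν, by rw [Matrix.add_mulVec, hμ, hν, add_smul]⟩
  algebraMap_mem' := by
    intro r i j
    exact ⟨r, by rw [Algebra.algebraMap_eq_smul_one, Matrix.smul_mulVec, Matrix.one_mulVec]⟩

/-- `W` is a spin model with loop variable `d`: `d² = n` and `W` satisfies
the type-I condition (constant diagonal `a ≠ 0` and constant row and column sums `d a⁻¹`),
the type-II condition, and the type-III (star-triangle) condition. -/
structure IsSpinModelWith (W : Matrix ι ι ℂ) (d : ℂ) : Prop where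
  loop : d ^ 2 = (Fintype.card ι : ℂ)
  typeI : ∃ a : ℂ, a ≠ 0 ∧ (∀ i, W i i = a) ∧
    (∀ i, ∑ j, W i j = d * a⁻¹) ∧ (∀ j, ∑ i, W i j = d * a⁻¹)
  typeII : IsTypeII W
  typeIII : ∀ h i j, ∑ k, W h k * W k i / W k j = d * W h i / (W i j * W h j)

/-- A spin model, with some loop variable. -/
def IsSpinModel (W : Matrix ι ι ℂ) : Prop := ∃ d : ℂ, IsSpinModelWith W d

/-- The `2n × 2n` matrix `W` built from `A`, `B` and the diagonal matrix `C`. -/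
def matW (A B C : Matrix ι ι ℂ) : Matrix (ι ⊕ ι) (ι ⊕ ι) ℂ :=
  Matrix.fromBlocks Aᵀ (-Aᵀ) ((schurInv B)ᵀ * C) ((schurInv B)ᵀ * C)

end

end JonesPairs

/-!
For a one-sided Jones pair `(A, B)`, each diagonal matrix `D` formed from a column of `B` satisfies
the braid relation `A D A = D A D`; hence conjugation by `A` turns `D` into `D⁻¹ A D`. When the pair
is invertible, this forces `A` and `B` to be type II and shows that `B` and `Bᵀ` exchange the ratio
vectors of the rows (or columns) of `A` with those of the rows of `B`. Consequently
`(0, B; Bᵀ, 0)` belongs to the Nomura algebra of `W`, hence to that of `Wᵀ`, so `B` and `Bᵀ` act by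
the same scalars on the ratio vectors of the columns of `A`. These span the whole space, so `B` is
symmetric, and the exchange relation carries the eigenvector property over to the ratio vectors of
`B` itself: `B` lies in its own Nomura algebra. A symmetric type-II matrix in its own Nomura algebra
is a scalar multiple of a spin model.
-/

namespace JonesPairs

open Matrix

section Braid

variable {G : Type*} [Group G] {a d : G}

lemma mul_mul_inv_of_braid (h : a * d * a = d * a * d) : a * d * a⁻¹ = d⁻¹ * a * d := by
  rw [mul_inv_eq_iff_eq_mul, mul_assoc, mul_assoc, eq_inv_mul_iff_mul_eq, ← mul_assoc,
    ← mul_assoc, h]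

lemma inv_mul_mul_of_braid (h : a * d * a = d * a * d) : a⁻¹ * d * a = d * a * d⁻¹ := by
  rw [eq_mul_inv_iff_mul_eq, mul_assoc, mul_assoc, inv_mul_eq_iff_eq_mul, ← mul_assoc,
    ← mul_assoc, h]

lemma mul_inv_mul_inv_of_braid (h : a * d * a = d * a * d) : a * d⁻¹ * a⁻¹ = d⁻¹ * a⁻¹ * d := by
  simpa only [_root_.mul_inv_rev, inv_inv, mul_assoc] using congrArg (·⁻¹) (mul_mul_inv_of_braid h)

end Braid

variable {ι : Type*} [Fintype ι]

lemma mul_diagonal_mul_apply {R : Type*} [NonUnitalSemiring R] [DecidableEq ι]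
    (M N : Matrix ι ι R) (v : ι → R) (i j : ι) :
    (M * diagonal v * N) i j = ∑ k, M i k * v k * N k j := by
  rw [mul_apply]
  simp only [mul_diagonal]

lemma cast_card_ne_zero (i : ι) : (Fintype.card ι : ℂ) ≠ 0 :=
  Nat.cast_ne_zero.2 (Fintype.card_pos_iff.2 ⟨i⟩).ne'

variable [DecidableEq ι] {A B C W : Matrix ι ι ℂ}

omit [Fintype ι] [DecidableEq ι] in
lemma ratioVec_self (hW : SchurInvertible W) (i : ι) : ratioVec W i i = 1 :=
  funext fun k => mul_inv_cancel₀ (hW k i)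

lemma isTypeII_iff : IsTypeII W ↔
    SchurInvertible W ∧ ∀ i j, i ≠ j → ∑ k, ratioVec Wᵀ i j k = 0 := by
  refine and_congr_right fun hW => ?_
  have entry (i j : ι) : (W * (schurInv W)ᵀ) i j = ∑ k, ratioVec Wᵀ i j k := rfl
  constructor
  · intro h i j hij
    rw [← entry, h, Matrix.smul_apply, one_apply_ne hij, smul_zero]
  · intro h
    ext i j
    rw [entry, Matrix.smul_apply]
    obtain rfl | hij := eq_or_ne i j
    · have hWT : SchurInvertible Wᵀ := fun k l => hW l k
      simp only [ratioVec_self hWT, Pi.one_apply, Finset.sum_const, Finset.card_univ,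
        nsmul_eq_mul, one_apply_eq, smul_eq_mul]
    · rw [h i j hij, one_apply_ne hij, smul_zero]

lemma ext_of_mulVec_ratioVec {M N : Matrix ι ι ℂ} (hA : IsUnit A) (hA' : SchurInvertible A)
    (h : ∀ i j, M *ᵥ ratioVec A i j = N *ᵥ ratioVec A i j) : M = N := by
  ext x j
  let D : Matrix ι ι ℂ := diagonal fun k => (A k j)⁻¹
  have hD : IsUnit D := isUnit_diagonal.2
    (Pi.isUnit_iff.2 fun k => (inv_ne_zero (hA' k j)).isUnit)
  have hcol (i : ι) : (D * A).col i = ratioVec A i j := by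
    ext k
    simp only [D, col_apply, diagonal_mul, ratioVec, schurInv, of_apply, mul_comm]
  have hmul : M * (D * A) = N * (D * A) := by
    ext y i
    exact congrFun (by simpa only [← hcol] using h i j) y
  rw [(hD.mul hA).mul_right_cancel hmul]

lemma isSpinModel_of_isEmpty [IsEmpty ι] (W : Matrix ι ι ℂ) : IsSpinModel W :=
  ⟨0, by simp, ⟨1, one_ne_zero, isEmptyElim, isEmptyElim, isEmptyElim⟩,
    ⟨isEmptyElim, Subsingleton.elim _ _⟩, isEmptyElim⟩

namespace IsTypeII

variable {β : ℂ} (hW : IsTypeII W)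
include hW

lemma transpose_schurInv_mul :
    (schurInv W)ᵀ * W = (Fintype.card ι : ℂ) • (1 : Matrix ι ι ℂ) := by
  ext i j
  have hn := cast_card_ne_zero i
  have hinv : W * ((Fintype.card ι : ℂ)⁻¹ • (schurInv W)ᵀ) = 1 := by
    rw [Matrix.mul_smul, hW.2, inv_smul_smul₀ hn]
  rw [mul_eq_one_comm, Matrix.smul_mul, inv_smul_eq_iff₀ hn] at hinv
  rw [hinv]

lemma smul_transpose_schurInv_mulVec {v : ι → ℂ} {μ : ℂ} (hv : W *ᵥ v = μ • v) :
    μ • (schurInv W)ᵀ *ᵥ v = (Fintype.card ι : ℂ) • v := by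
  rw [← mulVec_smul, ← hv, mulVec_mulVec, hW.transpose_schurInv_mul, smul_mulVec, one_mulVec]

lemma mul_sum_inv (hone : W *ᵥ 1 = β • 1) (j : ι) :
    β * ∑ k, (W k j)⁻¹ = Fintype.card ι := by
  simpa [mulVec, dotProduct, schurInv] using
    congrFun (hW.smul_transpose_schurInv_mulVec hone) j

lemma mulVec_ratioVec_of_mem_nomura (hmem : W ∈ nomura W) (hone : W *ᵥ 1 = β • 1) (i j : ι) :
    W *ᵥ ratioVec W i j = (β * W i i * (W i j)⁻¹) • ratioVec W i j := by
  obtain ⟨μ, hμ⟩ := hmem i j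
  have hentry : μ * ∑ k, (W k j)⁻¹ = Fintype.card ι * (W i i * (W i j)⁻¹) := by
    simpa [mulVec, dotProduct, ratioVec, schurInv, hW.1 _ i] using
      congrFun (hW.smul_transpose_schurInv_mulVec hμ) i
  have hμ_eq : μ = β * W i i * (W i j)⁻¹ := by
    apply mul_left_cancel₀ (cast_card_ne_zero i)
    linear_combination β * hentry - μ * hW.mul_sum_inv hone j
  rw [hμ, hμ_eq]

lemma diag_eq_of_mem_nomura (hsymm : W.IsSymm) (hmem : W ∈ nomura W) (hβ : β ≠ 0)
    (hone : W *ᵥ 1 = β • 1) (i j : ι) : W i i = W j j := by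
  have hcol : ∑ k, W j k * ratioVec W i j k = β := by
    calc ∑ k, W j k * ratioVec W i j k = ∑ k, W i k := by
          refine Finset.sum_congr rfl fun k _ => ?_
          have := hW.1 k j
          rw [hsymm.apply k j, hsymm.apply k i, ratioVec, schurInv, of_apply]
          field_simp
      _ = β := by simpa [mulVec, dotProduct] using congrFun hone i
  have heig : ∑ k, W j k * ratioVec W i j k =
      β * W i i * (W i j)⁻¹ * (W i j * (W j j)⁻¹) := by
    have := congrFun (hW.mulVec_ratioVec_of_mem_nomura hmem hone i j) j
    rwa [Pi.smul_apply, smul_eq_mul, ratioVec, schurInv, of_apply, hsymm.apply i j] at this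
  rw [hcol] at heig
  have := hW.1 i j
  have := hW.1 j j
  field_simp at heig
  exact heig.symm

lemma smul {α : ℂ} (hα : α ≠ 0) : IsTypeII (α • W) := by
  refine ⟨fun i j => mul_ne_zero hα (hW.1 i j), ?_⟩
  have hinv : schurInv (α • W) = α⁻¹ • schurInv W := by
    ext i j
    simp only [schurInv, of_apply, Matrix.smul_apply, smul_eq_mul, mul_inv]
  rw [hinv, transpose_smul, smul_mul_smul_comm, mul_inv_cancel₀ hα, one_smul, hW.2]

lemma isSpinModelWith_smul_of_star_triangle {α b d : ℂ} (hα : α ≠ 0) (hb : b ≠ 0)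
    (hd : d ^ 2 = Fintype.card ι) (hd_eq : d = α ^ 2 * (β * b))
    (hrow : ∀ i, ∑ j, W i j = β) (hcol : ∀ j, ∑ i, W i j = β) (hdiag : ∀ i, W i i = b)
    (hstar : ∀ h i j, ∑ k, W h k * W k i / W k j = β * b * W h i / (W i j * W h j)) :
    IsSpinModelWith (α • W) d where
  loop := hd
  typeI := by
    have hsum : α * β = d * (α * b)⁻¹ := by
      rw [hd_eq]
      field_simp
    refine ⟨α * b, mul_ne_zero hα hb, fun i => ?_, fun i => ?_, fun j => ?_⟩
    · rw [Matrix.smul_apply, hdiag, smul_eq_mul]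
    · simp only [Matrix.smul_apply, smul_eq_mul, ← Finset.mul_sum, hrow, hsum]
    · simp only [Matrix.smul_apply, smul_eq_mul, ← Finset.mul_sum, hcol, hsum]
  typeII := hW.smul hα
  typeIII h i j := by
    have hij := hW.1 i j
    have hhj := hW.1 h j
    calc ∑ k, (α • W) h k * (α • W) k i / (α • W) k j
        = α * ∑ k, W h k * W k i / W k j := by
          simp only [Matrix.smul_apply, smul_eq_mul, mul_assoc, mul_div_assoc,
            mul_div_mul_left _ _ hα, mul_left_comm _ α, Finset.mul_sum]
      _ = d * (α • W) h i / ((α • W) i j * (α • W) h j) := by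
          simp only [hstar, hd_eq, Matrix.smul_apply, smul_eq_mul]
          field_simp

lemma exists_smul_isSpinModel_of_mem_nomura (hsymm : W.IsSymm) (hmem : W ∈ nomura W) :
    ∃ α : ℂ, α ≠ 0 ∧ IsSpinModel (α • W) := by
  obtain hι | ⟨⟨o⟩⟩ := isEmpty_or_nonempty ι
  · exact ⟨1, one_ne_zero, isSpinModel_of_isEmpty _⟩
  have hn := cast_card_ne_zero o
  obtain ⟨β, hone⟩ : ∃ β : ℂ, W *ᵥ 1 = β • 1 := by
    simpa only [ratioVec_self hW.1] using hmem o o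
  have hβ : β ≠ 0 := left_ne_zero_of_mul (hW.mul_sum_inv hone o ▸ hn)
  have hrow (i : ι) : ∑ j, W i j = β := by
    simpa [mulVec, dotProduct] using congrFun hone i
  obtain ⟨d, hd⟩ := IsAlgClosed.exists_pow_nat_eq (Fintype.card ι : ℂ) two_pos
  -- `α • W` has diagonal entry `α b` and row sum `α β`, so type I forces `d = (α b) (α β)`.
  obtain ⟨α, hα⟩ := IsAlgClosed.exists_pow_nat_eq (d / (β * W o o)) two_pos
  have hd_eq : d = α ^ 2 * (β * W o o) := by
    rw [hα, div_mul_cancel₀ _ (mul_ne_zero hβ (hW.1 o o))]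
  have hd0 : d ≠ 0 := pow_ne_zero_iff two_ne_zero |>.1 (hd ▸ hn)
  have hα0 : α ≠ 0 := pow_ne_zero_iff two_ne_zero |>.1 (left_ne_zero_of_mul (hd_eq ▸ hd0))
  have hdiag (i : ι) : W i i = W o o := hW.diag_eq_of_mem_nomura hsymm hmem hβ hone i o
  refine ⟨α, hα0, d, hW.isSpinModelWith_smul_of_star_triangle hα0 (hW.1 o o) hd hd_eq hrow
    (fun j => ?_) hdiag fun h i j => ?_⟩
  · simpa only [hsymm.apply] using hrow j
  · have heig := congrFun (hW.mulVec_ratioVec_of_mem_nomura hmem hone i j) h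
    simp only [mulVec, dotProduct, ratioVec, schurInv, of_apply, Pi.smul_apply, smul_eq_mul,
      hdiag] at heig
    simp only [div_eq_mul_inv, mul_assoc, mul_inv] at heig ⊢
    rw [heig]
    ring

end IsTypeII

namespace IsOneSidedJonesPair

variable (h : IsOneSidedJonesPair A B)
include h

lemma isUnit : IsUnit A := Algebra.lmul_isUnit_iff.1 h.isUnit_opX

lemma schurInvertible : SchurInvertible B := by
  intro i j hij
  have hker : opD B (single i j 1) = opD B 0 := by
    rw [map_zero]
    ext x y
    by_cases hxy : i = x ∧ j = y
    · obtain ⟨rfl, rfl⟩ := hxy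
      simp [opD, hij]
    · simp [opD, single, hxy]
  simpa using congrFun (congrFun (((Module.End.isUnit_iff _).1 h.isUnit_opD).1 hker) i) j

lemma braid_diagonal_col (j : ι) :
    A * diagonal (B.col j) * A = diagonal (B.col j) * A * diagonal (B.col j) := by
  ext x i
  -- Evaluate the braid relation at the matrix unit `single i j 1` and read off the entry `(x, j)`.
  have hbraid := congrFun (congrFun (LinearMap.congr_fun h.braid (single i j 1)) x) j
  have hsingle : B ⊙ single i j (1 : ℂ) = single i j (B i j) := by
    ext x y
    by_cases hxy : i = x ∧ j = y
    · obtain ⟨rfl, rfl⟩ := hxy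
      simp
    · simp [single, hxy]
  simp only [opX, opD, Module.End.mul_apply, LinearMap.mulLeft_apply, LinearMap.coe_mk,
    AddHom.coe_mk, hsingle, hadamard_apply, mul_single_apply_same] at hbraid
  rw [mul_apply] at hbraid
  simp only [hadamard_apply, mul_single_apply_same, mul_one] at hbraid
  rw [mul_diagonal_mul_apply, mul_diagonal, diagonal_mul]
  simpa only [col_apply, mul_assoc] using hbraid

lemma exists_units_braid (j : ι) : ∃ a d : (Matrix ι ι ℂ)ˣ, (a : Matrix ι ι ℂ) = A ∧
    (d : Matrix ι ι ℂ) = diagonal (B.col j) ∧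
    ((d⁻¹ : (Matrix ι ι ℂ)ˣ) : Matrix ι ι ℂ) = diagonal ((schurInv B).col j) ∧
    a * d * a = d * a * d := by
  have hmul (k : ι) : B k j * (B k j)⁻¹ = 1 := mul_inv_cancel₀ (h.schurInvertible k j)
  obtain ⟨a, rfl⟩ := h.isUnit
  refine ⟨a, ⟨diagonal (B.col j), diagonal ((schurInv B).col j), ?_, ?_⟩, rfl, rfl, rfl,
    Units.ext (h.braid_diagonal_col j)⟩
  · simp [schurInv, hmul]
  · simp [schurInv, mul_comm _ (B _ j), hmul]

lemma transpose_mulVec_one : Bᵀ *ᵥ 1 = A.trace • 1 := by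
  ext j
  obtain ⟨a, d, rfl, hd, -, hbraid⟩ := h.exists_units_braid j
  have htrace := congrArg (fun u : (Matrix ι ι ℂ)ˣ => (u : Matrix ι ι ℂ).trace)
    (mul_mul_inv_of_braid hbraid)
  simp only [Units.val_mul, trace_units_conj, trace_units_conj'] at htrace
  rw [hd] at htrace
  simpa [mulVec, dotProduct, trace] using htrace

lemma sum_conj (x i j : ι) :
    ∑ k, A x k * B k j * A⁻¹ k i = (B x j)⁻¹ * A x i * B i j := by
  obtain ⟨a, d, rfl, hd, hd', hbraid⟩ := h.exists_units_braid j
  have hentry := congrArg (fun u : (Matrix ι ι ℂ)ˣ => (u : Matrix ι ι ℂ) x i)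
    (mul_mul_inv_of_braid hbraid)
  simpa only [Units.val_mul, hd, hd', coe_units_inv, mul_diagonal_mul_apply, mul_diagonal,
    diagonal_mul, col_apply, schurInv, of_apply] using hentry

lemma sum_inv_conj (x i j : ι) :
    ∑ k, A⁻¹ x k * B k j * A k i = B x j * A x i * (B i j)⁻¹ := by
  obtain ⟨a, d, rfl, hd, hd', hbraid⟩ := h.exists_units_braid j
  have hentry := congrArg (fun u : (Matrix ι ι ℂ)ˣ => (u : Matrix ι ι ℂ) x i)
    (inv_mul_mul_of_braid hbraid)
  simpa only [Units.val_mul, hd, hd', coe_units_inv, mul_diagonal_mul_apply, mul_diagonal,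
    diagonal_mul, col_apply, schurInv, of_apply] using hentry

lemma sum_conj_inv (x i j : ι) :
    ∑ k, A x k * (B k j)⁻¹ * A⁻¹ k i = (B x j)⁻¹ * A⁻¹ x i * B i j := by
  obtain ⟨a, d, rfl, hd, hd', hbraid⟩ := h.exists_units_braid j
  have hentry := congrArg (fun u : (Matrix ι ι ℂ)ˣ => (u : Matrix ι ι ℂ) x i)
    (mul_inv_mul_inv_of_braid hbraid)
  simpa only [Units.val_mul, hd, hd', coe_units_inv, mul_diagonal_mul_apply, mul_diagonal,
    diagonal_mul, col_apply, schurInv, of_apply] using hentry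

end IsOneSidedJonesPair

lemma IsJonesPair.mulVec_one (h : IsJonesPair A B) : B *ᵥ 1 = A.trace • 1 :=
  h.right.transpose_mulVec_one

namespace IsInvertibleJonesPair

variable (h : IsInvertibleJonesPair A B)
include h

lemma inv_apply (i k : ι) : A⁻¹ i k = (Fintype.card ι : ℂ)⁻¹ * (A k i)⁻¹ := by
  have hleft := h.isJonesPair.left
  let v : ι → ℂ := fun k => A⁻¹ i k * A k i
  have hv : v ᵥ* B = A i i • 1 := by
    ext j
    have hB := hleft.schurInvertible i j
    calc ∑ k, A⁻¹ i k * A k i * B k j = ∑ k, A⁻¹ i k * B k j * A k i := by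
          simp only [mul_right_comm]
      _ = A i i * 1 := by
          rw [hleft.sum_inv_conj]
          field_simp
  have hconst : A.trace • v = A i i • 1 := by
    apply vecMul_injective_of_isUnit h.isUnit
    simp only [smul_vecMul, hv, ← mulVec_transpose B 1, hleft.transpose_mulVec_one,
      smul_comm A.trace]
  have hsum : ∑ k, v k = 1 := by
    change (A⁻¹ * A) i i = 1
    rw [nonsing_inv_mul A ((isUnit_iff_isUnit_det A).1 hleft.isUnit), one_apply_eq]
  have htrace : A.trace = Fintype.card ι * A i i := by
    have := congrArg (fun w : ι → ℂ => ∑ k, w k) hconst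
    simpa [← Finset.mul_sum, hsum] using this
  have hentry : A.trace * (A⁻¹ i k * A k i) = A i i := by
    simpa [v] using congrFun hconst k
  have hii := h.schurInvertible i i
  have hki := h.schurInvertible k i
  have hn := cast_card_ne_zero i
  rw [htrace] at hentry
  field_simp at hentry ⊢
  linear_combination hentry

lemma isTypeII_left : IsTypeII A := by
  refine isTypeII_iff.2 ⟨h.schurInvertible, fun i j hij => ?_⟩
  have hinv : ∑ k, A i k * A⁻¹ k j = 0 := by
    rw [← mul_apply, mul_nonsing_inv A ((isUnit_iff_isUnit_det A).1 h.isJonesPair.left.isUnit),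
      one_apply_ne hij]
  simp only [h.inv_apply, mul_left_comm _ (Fintype.card ι : ℂ)⁻¹, ← Finset.mul_sum] at hinv
  exact (mul_eq_zero.1 hinv).resolve_left (inv_ne_zero (cast_card_ne_zero i))

lemma transpose_mulVec_ratioVec_transpose_left (i j : ι) :
    Bᵀ *ᵥ ratioVec Aᵀ i j = (Fintype.card ι * A i j) • ratioVec Bᵀ j i := by
  ext l
  have hsum := h.isJonesPair.left.sum_conj i j l
  simp only [h.inv_apply, mul_left_comm _ (Fintype.card ι : ℂ)⁻¹, ← Finset.mul_sum,
    inv_mul_eq_iff_eq_mul₀ (cast_card_ne_zero i)] at hsum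
  calc ∑ k, B k l * (A i k * (A j k)⁻¹) = ∑ k, A i k * B k l * (A j k)⁻¹ := by
        simp only [mul_assoc, mul_left_comm (B _ l)]
    _ = Fintype.card ι * A i j * (B j l * (B i l)⁻¹) := by rw [hsum]; ring

lemma transpose_mulVec_ratioVec_left (i j : ι) :
    Bᵀ *ᵥ ratioVec A i j = (Fintype.card ι * A j i) • ratioVec Bᵀ j i := by
  ext l
  have hsum := h.isJonesPair.left.sum_inv_conj j i l
  simp only [h.inv_apply, mul_assoc (Fintype.card ι : ℂ)⁻¹, ← Finset.mul_sum,
    inv_mul_eq_iff_eq_mul₀ (cast_card_ne_zero i)] at hsum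
  calc ∑ k, B k l * (A k i * (A k j)⁻¹) = ∑ k, (A k j)⁻¹ * B k l * A k i :=
        Finset.sum_congr rfl fun k _ => by ring
    _ = Fintype.card ι * A j i * (B j l * (B i l)⁻¹) := by rw [hsum]; ring

lemma transpose_schurInv_mulVec_ratioVec_transpose_left (i j : ι) :
    (schurInv B)ᵀ *ᵥ ratioVec Aᵀ i j = (A j i)⁻¹ • ratioVec Bᵀ j i := by
  ext l
  have hn := cast_card_ne_zero i
  have hsum := h.isJonesPair.left.sum_conj_inv i j l
  simp only [h.inv_apply, mul_left_comm _ (Fintype.card ι : ℂ)⁻¹, ← Finset.mul_sum,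
    inv_mul_eq_iff_eq_mul₀ hn] at hsum
  calc ∑ k, (B k l)⁻¹ * (A i k * (A j k)⁻¹) = ∑ k, A i k * (B k l)⁻¹ * (A j k)⁻¹ := by
        simp only [mul_assoc, mul_left_comm (B _ l)⁻¹]
    _ = (A j i)⁻¹ * (B j l * (B i l)⁻¹) := by rw [hsum]; field_simp

lemma isTypeII_right : IsTypeII B := by
  refine isTypeII_iff.2 ⟨h.isJonesPair.left.schurInvertible, fun i j hij => ?_⟩
  have hzero : (Fintype.card ι * A j i) * ∑ k, ratioVec Bᵀ i j k = 0 := by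
    calc (Fintype.card ι * A j i) * ∑ k, ratioVec Bᵀ i j k
        = 1 ⬝ᵥ Bᵀ *ᵥ ratioVec Aᵀ j i := by
          rw [h.transpose_mulVec_ratioVec_transpose_left, dotProduct_smul, one_dotProduct,
            smul_eq_mul]
      _ = A.trace * ∑ k, ratioVec Aᵀ j i k := by
          rw [dotProduct_mulVec, vecMul_transpose, h.isJonesPair.mulVec_one, smul_dotProduct,
            one_dotProduct, smul_eq_mul]
      _ = 0 := by rw [(isTypeII_iff.1 h.isTypeII_left).2 j i hij.symm, mul_zero]
  exact (mul_eq_zero.1 hzero).resolve_left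
    (mul_ne_zero (cast_card_ne_zero i) (h.schurInvertible j i))

lemma mulVec_ratioVec_transpose_right (i j : ι) :
    B *ᵥ ratioVec Bᵀ j i = (Fintype.card ι * A j i) • ratioVec Aᵀ i j := by
  have hratio : ratioVec Bᵀ j i = A j i • (schurInv B)ᵀ *ᵥ ratioVec Aᵀ i j := by
    rw [h.transpose_schurInv_mulVec_ratioVec_transpose_left,
      smul_inv_smul₀ (h.schurInvertible j i)]
  rw [hratio, mulVec_smul, mulVec_mulVec, h.isTypeII_right.2, smul_mulVec, one_mulVec, smul_smul,
    mul_comm]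

end IsInvertibleJonesPair

lemma exists_ratioVec_matW_diagonal (c : ι → ℂ) (p q : ι ⊕ ι) :
    ∃ (i j : ι) (ε : ℂ), ε * ε = 1 ∧ ratioVec (matW A B (diagonal c)) p q =
      Sum.elim (ε • ratioVec Aᵀ i j) ((c i / c j) • ratioVec Bᵀ j i) := by
  have hbot (i j k : ι) : (B i k)⁻¹ * c i * ((c j)⁻¹ * B j k) =
      c i / c j * (B j k * (B i k)⁻¹) := by ring
  rcases p with i | i <;> rcases q with j | j
  · refine ⟨i, j, 1, one_mul 1, ?_⟩
    ext (k | k) <;> simp [ratioVec, matW, schurInv, mul_diagonal, hbot]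
  · refine ⟨i, j, -1, by norm_num, ?_⟩
    ext (k | k) <;> simp [ratioVec, matW, schurInv, mul_diagonal, hbot, inv_neg]
  · refine ⟨i, j, -1, by norm_num, ?_⟩
    ext (k | k) <;> simp [ratioVec, matW, schurInv, mul_diagonal, hbot]
  · refine ⟨i, j, 1, one_mul 1, ?_⟩
    ext (k | k) <;> simp [ratioVec, matW, schurInv, mul_diagonal, hbot, inv_neg]

omit [DecidableEq ι] in
lemma ratioVec_transpose_matW_inl (i j : ι) :
    ratioVec (matW A B C)ᵀ (Sum.inl i) (Sum.inl j) =
      Sum.elim (ratioVec A i j) (ratioVec A i j) := by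
  ext (k | k) <;> simp [ratioVec, matW, schurInv, inv_neg]

lemma exists_eigenvalue_of_fromBlocks_mem_nomura
    (hmem : fromBlocks 0 B Bᵀ 0 ∈ nomura (matW A B C)ᵀ) (i j : ι) :
    ∃ μ : ℂ, B *ᵥ ratioVec A i j = μ • ratioVec A i j ∧
      Bᵀ *ᵥ ratioVec A i j = μ • ratioVec A i j := by
  obtain ⟨μ, hμ⟩ := hmem (Sum.inl i) (Sum.inl j)
  rw [ratioVec_transpose_matW_inl, fromBlocks_mulVec] at hμ
  refine ⟨μ, funext fun k => ?_, funext fun k => ?_⟩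
  · simpa using congrFun hμ (Sum.inl k)
  · simpa using congrFun hμ (Sum.inr k)

lemma sq_mul_eq_mul_sq_of_transpose_eq {c : ι → ℂ} (hc : IsUnit (diagonal c))
    (hA : Aᵀ = (diagonal c ^ 2)⁻¹ * A * diagonal c ^ 2) (i j : ι) :
    c i ^ 2 * A j i = A i j * c j ^ 2 := by
  have hmul : diagonal c ^ 2 * Aᵀ = A * diagonal c ^ 2 := by
    rw [hA, Matrix.mul_assoc, mul_nonsing_inv_cancel_left]
    exact (isUnit_iff_isUnit_det _).1 (hc.pow 2)
  have hentry := congrFun (congrFun hmul i) j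
  rwa [diagonal_pow, diagonal_mul, mul_diagonal] at hentry

namespace IsInvertibleJonesPair

variable (h : IsInvertibleJonesPair A B)
include h

lemma fromBlocks_mem_nomura_matW (hCdiag : C.IsDiag) (hCunit : IsUnit C)
    (hC : Aᵀ = (C ^ 2)⁻¹ * A * C ^ 2) : fromBlocks 0 B Bᵀ 0 ∈ nomura (matW A B C) := by
  obtain ⟨c, rfl⟩ : ∃ c, C = diagonal c := ⟨_, hCdiag.diagonal_diag.symm⟩
  have hc (i : ι) : c i ≠ 0 := (Pi.isUnit_iff.1 (isUnit_diagonal.1 hCunit) i).ne_zero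
  intro p q
  obtain ⟨i, j, ε, hε, hratio⟩ := exists_ratioVec_matW_diagonal (A := A) (B := B) c p q
  have hi := hc i
  have hj := hc j
  have hA := sq_mul_eq_mul_sq_of_transpose_eq hCunit hC i j
  have htop : c i / c j * (Fintype.card ι * A j i) =
      ε * (Fintype.card ι * A i j) * (c j / c i) * ε := by
    field_simp
    linear_combination Fintype.card ι * hA - Fintype.card ι * A i j * c j ^ 2 * hε
  have hbot : ε * (Fintype.card ι * A i j) =
      ε * (Fintype.card ι * A i j) * (c j / c i) * (c i / c j) := by
    field_simp
  refine ⟨ε * (Fintype.card ι * A i j) * (c j / c i), ?_⟩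
  rw [hratio, fromBlocks_mulVec]
  simp only [Sum.elim_comp_inl, Sum.elim_comp_inr, zero_mulVec, mulVec_smul, smul_zero,
    zero_add, add_zero, h.mulVec_ratioVec_transpose_right,
    h.transpose_mulVec_ratioVec_transpose_left]
  ext (k | k)
  · simp only [Sum.elim_inl, Pi.smul_apply, smul_eq_mul]
    linear_combination ratioVec Aᵀ i j k * htop
  · simp only [Sum.elim_inr, Pi.smul_apply, smul_eq_mul]
    linear_combination ratioVec Bᵀ j i k * hbot

lemma isSymm_of_fromBlocks_mem_nomura (hmem : fromBlocks 0 B Bᵀ 0 ∈ nomura (matW A B C)ᵀ) :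
    B.IsSymm := by
  refine ext_of_mulVec_ratioVec h.isJonesPair.left.isUnit h.schurInvertible fun i j => ?_
  obtain ⟨μ, hμ, hμT⟩ := exists_eigenvalue_of_fromBlocks_mem_nomura hmem i j
  rw [hμ, hμT]

lemma mem_nomura_of_fromBlocks_mem_nomura
    (hmem : fromBlocks 0 B Bᵀ 0 ∈ nomura (matW A B C)ᵀ) : B ∈ nomura B := by
  intro i j
  obtain ⟨μ, hμ, -⟩ := exists_eigenvalue_of_fromBlocks_mem_nomura hmem j i
  have hratio := h.transpose_mulVec_ratioVec_left j i
  rw [(h.isSymm_of_fromBlocks_mem_nomura hmem).eq] at hratio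
  have hn : Fintype.card ι * A i j ≠ 0 := mul_ne_zero (cast_card_ne_zero i) (h.schurInvertible i j)
  rw [← inv_smul_eq_iff₀ hn] at hratio
  exact ⟨μ, by rw [← hratio, mulVec_smul, hμ, mulVec_smul, hμ, smul_comm _ μ]⟩

end IsInvertibleJonesPair

end JonesPairs

theorem mainTheorem12_general {ι : Type*} [Fintype ι] [DecidableEq ι] (A B C : Matrix ι ι ℂ)
    (hAB : JonesPairs.IsInvertibleJonesPair A B)
    (hCdiag : C.IsDiag) (hCunit : IsUnit C)
    (hC : Aᵀ = (C ^ 2)⁻¹ * A * C ^ 2)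
    (hW : JonesPairs.nomura (JonesPairs.matW A B C) ≤
      JonesPairs.nomura (JonesPairs.matW A B C)ᵀ) :
    ∃ α : ℂ, α ≠ 0 ∧ JonesPairs.IsSpinModel (α • B) := by
  have hmem := hW (hAB.fromBlocks_mem_nomura_matW hCdiag hCunit hC)
  have hsymm := hAB.isSymm_of_fromBlocks_mem_nomura hmem
  have hmem_nomura := hAB.mem_nomura_of_fromBlocks_mem_nomura hmem
  exact hAB.isTypeII_right.exists_smul_isSpinModel_of_mem_nomura hsymm hmem_nomura

theorem mainTheorem12 (n : ℕ) (A B C : Matrix (Fin n) (Fin n) ℂ)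
    (hAB : JonesPairs.IsInvertibleJonesPair A B)
    (hCdiag : C.IsDiag) (hCunit : IsUnit C)
    (hC : Aᵀ = (C ^ 2)⁻¹ * A * C ^ 2)
    (hW : JonesPairs.nomura (JonesPairs.matW A B C) =
      JonesPairs.nomura (JonesPairs.matW A B C)ᵀ) :
    ∃ α : ℂ, α ≠ 0 ∧ JonesPairs.IsSpinModel (α • B) :=
  mainTheorem12_general A B C hAB hCdiag hCunit hC hW.le
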